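/- **Setting.** For a set $Y$ let $\mathbb F_{[0,\infty]}Y$ be the set of functions $Y\to[0,\infty]$ with at most countable support. Let $\mathsf K=\mathcal Kl(\mathbb F_{[0,\infty]})$ be the Kleisli category restricted to at most countable sets: a morphism $f:X\to Y$ is a map $X\to \mathbb F_{[0,\infty]}Y$, composition is $(g\circ f)(x)(z)=\sum_{y} f(x)(y)\,g(y)(z)$, and hom-sets are ordered pointwise; this category is $\mathsf{DCpo}^\vee$-enriched (directed suprema, preserved by composition, and binary joins). A map of sets $f:X\to Y$ is regarded as the morphism $f^\sharp:X\to Y$, $f^\sharp(x)(y)=1$ if $y=f(x)$ and $0$ otherwise. Let $\widehat{\mathsf K}$ have the objects $\widehat X$ ($X\in\mathsf K$), where a morphism $\varphi:\widehat X\to\widehat Y$ is a family of Scott-continuous maps $\varphi_Z:\mathsf K(Y,Z)\to\mathsf K(X,Z)$ ($Z \in \mathsf K$) with $\varphi_{Z'}(g\circ h)\le g\circ\varphi_Z(h)$ for $h:Y\to Z$, $g:Z\to Z'$; the order is pointwise and $(\psi\circ\varphi)_Z=\varphi_Z\circ\psi_Z$. For $f\in\mathsf K(X,Y)$ put $\widehat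 f_Z(h)=h\circ f$, and for $\varphi:\widehat X\to\widehat Y$ put $\Theta(\varphi)=\varphi_Y(\mathrm{id}_Y)\in\mathsf K(X,Y)$. A lax functor $\pi:[0,\infty)\to\mathsf K$ on the additive monoid $[0,\infty)$ with carrier $X$ is a family $\pi_t:X\to X$ in $\mathsf K$ with $\mathrm{id}\le\pi_0$ and $\pi_s\circ\pi_t\le\pi_{s+t}$; it is strict if equalities hold. Let $\Sigma_!(\widehat\pi)=\bigvee_{l\in\mathbb N}(\bigvee\widehat\Pi)^l$ in $\widehat{\mathsf K}(\widehat X,\widehat X)$, where $\widehat\Pi=\{\widehat{\pi_{t_1}}\vee\dots\vee\widehat{\pi_{t_k}}: k\ge1,\ t_i\in[0,\infty)\}$. A relation $R$ on $X$ is a *weak bisimulation* on $\pi$ if there are an at most countable set $Y$ and a map $f:X\to Y$ with $(i,j)\in R\iff f(i)=f(j)$, such that $\Theta(\widehat{f^\sharp}\circ\Sigma_!(\widehat\pi))=\Theta(\widehat\beta\circ\widehat{f^\sharp})$ for some $\beta\in\mathsf K(Y,Y)$. **Theorem.** Let $(X_t)_{t\ge0}$ be a continuous-time Markov chain on an at most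 countable state space $S$, with almost surely right-continuous paths ($S$ discrete) and with $\mathbb P(X_0=i)>0$ for every $i\in S$. Assume that it is homogeneous, i.e. $\mathbb P(X_{s+t}=j\mid X_s=i)=\mathbb P(X_t=j\mid X_0=i)$ whenever $\mathbb P(X_s=i)>0$. Put $p_{ij}(t)=\mathbb P(X_t=j\mid X_0=i)$ and, for $C\subseteq S$, $p_{i,C}=\mathbb P(X_t\in C\text{ for some }t\ge0\mid X_0=i)$. Then: 1. $\pi_t(i)(j)=p_{ij}(t)$ defines a strict functor $\pi:[0,\infty)\to\mathcal Kl(\mathbb F_{[0,\infty]})$ with carrier $S$. 2. For every equivalence relation $R$ on $S$, every $R$-class $C$ and every $i\in S$: $p_{i,C}=1$ if $i\in C$, and $p_{i,C}=\sup_{t\ge0}\sum_{j\in S}p_{j,C}\,p_{ij}(t)$ if $i\notin C$. 3. If $R$ is an equivalence relation on $S$ such that $p_{i,C}=p_{j,C}$ for all $(i,j)\in R$ and all $R$-classes $C$, then $R$ is a weak bisimulation on $\pi$. -/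

import Mathlib

open MeasureTheory ProbabilityTheory CategoryTheory Topology
open scoped NNReal ENNReal

universe u v w

/-! ### `DCpo^∨`-enriched categories -/

/-- A `DCpo^∨`-enriched category: every hom-set is a poset with suprema of (nonempty) directed
sets and with binary joins, and composition is Scott-continuous in each argument. -/
class DCpoJoinEnriched (K : Type v) [Category.{w} K] where
  homOrder : ∀ X Y : K, PartialOrder (X ⟶ Y)
  exists_isLUB_of_directed : ∀ {X Y : K} (d : Set (X ⟶ Y)), d.Nonempty →
    DirectedOn (· ≤ ·) d → ∃ a, IsLUB d a
  exists_isLUB_pair : ∀ {X Y : K} (f g : X ⟶ Y), ∃ a, IsLUB {f, g} a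
  scottContinuous_precomp : ∀ {X Y : K} (f : X ⟶ Y) (Z : K),
    ScottContinuous fun h : Y ⟶ Z => f ≫ h
  scottContinuous_postcomp : ∀ {Y Z : K} (g : Y ⟶ Z) (X : K),
    ScottContinuous fun h : X ⟶ Y => h ≫ g

attribute [reducible, instance] DCpoJoinEnriched.homOrder

section Hat

variable {K : Type v} [Category.{w} K] [DCpoJoinEnriched K]

/-! ### The locally reflective embedding of `K` into a left distributive category -/

/-- A morphism from `K(X,-)` to `K(Y,-)` in the category `hat K`, that is, an oplax transformation
from the functor `K(Y,-) : K → DCpo^∨` to the functor `K(X,-) : K → DCpo^∨`. -/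
@[ext]
structure HatHom (X Y : K) where
  app : ∀ Z : K, (Y ⟶ Z) → (X ⟶ Z)
  scottContinuous : ∀ Z : K, ScottContinuous (app Z)
  oplax : ∀ {Z Z' : K} (h : Y ⟶ Z) (g : Z ⟶ Z'), app Z' (h ≫ g) ≤ app Z h ≫ g

variable (K) in
/-- The category `hat K`; its objects are the functors `K(X,-)` for `X` in `K`. -/
structure Hat where
  base : K

instance : Category.{max v w} (Hat K) where
  Hom X Y := HatHom X.base Y.base
  id X := ⟨fun _ h => h, fun _ => ScottContinuous.id, fun _ _ => le_rfl⟩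
  comp φ ψ := ⟨fun Z h => φ.app Z (ψ.app Z h),
    fun Z => (ψ.scottContinuous Z).comp (φ.scottContinuous Z),
    fun h g => ((φ.scottContinuous _).monotone (ψ.oplax h g)).trans (φ.oplax _ g)⟩

instance (X Y : Hat K) : PartialOrder (X ⟶ Y) where
  le φ ψ := ∀ (Z : K) (h : Y.base ⟶ Z), HatHom.app φ Z h ≤ HatHom.app ψ Z h
  le_refl _ _ _ := le_rfl
  le_trans _ _ _ h₁ h₂ Z h := (h₁ Z h).trans (h₂ Z h)
  le_antisymm _ _ h₁ h₂ := HatHom.ext (funext fun Z => funext fun h =>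
    le_antisymm (h₁ Z h) (h₂ Z h))

/-- The embedding `f ↦ K(f,-)` of `K` into `hat K`. -/
def hat {X Y : K} (f : X ⟶ Y) : Hat.mk X ⟶ Hat.mk Y :=
  HatHom.mk (fun _ h => f ≫ h) (fun Z => DCpoJoinEnriched.scottContinuous_precomp f Z)
    (fun h g => le_of_eq (Category.assoc f h g).symm)

/-- The left adjoint `Θ` of the embedding `K(X,Y) → hat K (hat X, hat Y)`. -/
def Theta {X Y : K} (φ : Hat.mk X ⟶ Hat.mk Y) : X ⟶ Y :=
  HatHom.app φ Y (𝟙 Y)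

/-- The powers `φ^l` of an endomorphism. -/
def hatPow {X : Hat K} (φ : X ⟶ X) : ℕ → (X ⟶ X)
  | 0 => 𝟙 X
  | l + 1 => hatPow φ l ≫ φ

/-! ### Lax functors on a monoid and their weak behavioural morphisms -/

/-- A lax functor from a monoid `M` (a one-object category, written additively) to `K`, with
carrier `X`. -/
structure LaxFlow (M : Type*) [AddMonoid M] (X : K) where
  map : M → (X ⟶ X)
  id_le : 𝟙 X ≤ map 0
  comp_le : ∀ m n : M, map n ≫ map m ≤ map (m + n)

/-- A lax functor is a strict functor if it preserves identities and composition. -/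
def LaxFlow.IsStrict {M : Type*} [AddMonoid M] {X : K} (π : LaxFlow M X) : Prop :=
  π.map 0 = 𝟙 X ∧ ∀ m n : M, π.map (m + n) = π.map n ≫ π.map m

/-- The set of all finite joins `π̂(m₁) ∨ … ∨ π̂(mₖ)`, `k ≥ 1`, in `hat K`. -/
def LaxFlow.finiteJoins {M : Type*} [AddMonoid M] {X : K} (π : LaxFlow M X) :
    Set (Hat.mk X ⟶ Hat.mk X) :=
  {φ | ∃ s : Finset M, s.Nonempty ∧ IsLUB ((fun m => hat (π.map m)) '' (s : Set M)) φ}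

/-- `σ` is the saturation `Σ_!(π̂) = ⋁_l (⋁ Π̂)^l` in `hat K`, where `Π̂` is the set of finite joins
of the morphisms `π̂(m)`. For a one-object domain the coproduct over all objects is the carrier. -/
def LaxFlow.IsSaturation {M : Type*} [AddMonoid M] {X : K} (π : LaxFlow M X)
    (σ : Hat.mk X ⟶ Hat.mk X) : Prop :=
  ∃ ρ : Hat.mk X ⟶ Hat.mk X, IsLUB π.finiteJoins ρ ∧ IsLUB (Set.range (hatPow ρ)) σ

/-- `f` is a weak behavioural morphism on `π`: there is an endomorphism `β` with
`Θ(f̂ ∘ Σ_!(π̂)) = Θ(β̂ ∘ f̂)`. -/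
def LaxFlow.IsWeakBehavioural {M : Type*} [AddMonoid M] {X : K} (π : LaxFlow M X) {Y : K}
    (f : X ⟶ Y) : Prop :=
  ∃ (β : Y ⟶ Y) (σ : Hat.mk X ⟶ Hat.mk X), π.IsSaturation σ ∧
    Theta (σ ≫ hat f) = Theta (hat f ≫ hat β)

end Hat

/-! ### The monad `F_{[0,∞]}` and its Kleisli category -/

/-- `F_{[0,∞]} X`: the functions `X → [0,∞]` with at most countable support. -/
def FMonad (X : Type u) : Type u :=
  {φ : X → ℝ≥0∞ // (Function.support φ).Countable}

namespace FMonad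

instance {X : Type u} : CoeFun (FMonad X) fun _ => X → ℝ≥0∞ := ⟨Subtype.val⟩

instance {X : Type u} : PartialOrder (FMonad X) :=
  inferInstanceAs (PartialOrder {φ : X → ℝ≥0∞ // (Function.support φ).Countable})

theorem ext {X : Type u} {φ ψ : FMonad X} (h : ∀ x, φ x = ψ x) : φ = ψ :=
  Subtype.ext (funext h)

open Classical in
/-- The unit `x ↦ 1 · x`. -/
noncomputable def unit {X : Type u} (x : X) : FMonad X :=
  ⟨fun y => if y = x then 1 else 0, (Set.countable_singleton x).mono fun y hy => by
    by_contra h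
    exact hy (if_neg h)⟩

/-- The Kleisli extension `φ ↦ ∑_x φ(x) · g(x)` of `g`. -/
noncomputable def bind {X Y : Type u} (φ : FMonad X) (g : X → FMonad Y) : FMonad Y :=
  ⟨fun y => ∑' x, φ x * g x y,
    (φ.2.biUnion fun x _ => (g x).2).mono fun y hy => by
      by_contra h
      refine hy (ENNReal.tsum_eq_zero.2 fun x => ?_)
      by_contra hx
      exact h (Set.mem_biUnion (x := x) (left_ne_zero_of_mul hx) (right_ne_zero_of_mul hx))⟩

theorem unit_bind {X Y : Type u} (x : X) (g : X → FMonad Y) : (unit x).bind g = g x := by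
  refine ext fun y => ?_
  refine (tsum_eq_single x fun x' hx' => ?_).trans ?_
  · simp [unit, hx']
  · simp [unit]

theorem bind_unit {X : Type u} (φ : FMonad X) : φ.bind unit = φ := by
  refine ext fun y => ?_
  refine (tsum_eq_single y fun x' hx' => ?_).trans ?_
  · simp [unit, hx'.symm]
  · simp [unit]

theorem bind_assoc {X Y Z : Type u} (φ : FMonad X) (g : X → FMonad Y) (k : Y → FMonad Z) :
    (φ.bind g).bind k = φ.bind fun x => (g x).bind k := by
  refine ext fun z => ?_
  change ∑' y, (∑' x, φ x * g x y) * k y z = ∑' x, φ x * ∑' y, g x y * k y z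
  simp_rw [← ENNReal.tsum_mul_right, ← ENNReal.tsum_mul_left]
  rw [ENNReal.tsum_comm]
  simp_rw [mul_assoc]

end FMonad

/-- The objects of the Kleisli category of `F_{[0,∞]}` that are used: the at most countable sets.
On uncountable sets directed suprema of Kleisli morphisms need not have countable support. -/
structure KlF : Type (u + 1) where
  carrier : Type u
  countable : Countable carrier

/-- The Kleisli morphisms from `X` to `Y`: the maps `X → F_{[0,∞]} Y`. -/
@[ext]
structure KlFHom (X Y : KlF.{u}) : Type u where
  app : X.carrier → FMonad Y.carrier

namespace KlF

/-- A countable type as an object. -/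
def of (S : Type u) [hS : Countable S] : KlF.{u} := ⟨S, hS⟩

noncomputable instance : Category KlF.{u} where
  Hom X Y := KlFHom X Y
  id _ := ⟨FMonad.unit⟩
  comp f g := ⟨fun x => (f.app x).bind g.app⟩
  id_comp _ := KlFHom.ext (funext fun _ => FMonad.unit_bind _ _)
  comp_id _ := KlFHom.ext (funext fun _ => FMonad.bind_unit _)
  assoc _ _ _ := KlFHom.ext (funext fun _ => FMonad.bind_assoc _ _ _)

/-- The entry `f(x)(y)` of a Kleisli morphism. -/
def entry {X Y : KlF.{u}} (f : X ⟶ Y) (x : X.carrier) (y : Y.carrier) : ℝ≥0∞ :=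
  (KlFHom.app f x) y

theorem hom_ext {X Y : KlF.{u}} {f g : X ⟶ Y} (h : ∀ x y, entry f x y = entry g x y) : f = g :=
  KlFHom.ext (funext fun x => FMonad.ext (h x))

/-- The pointwise order. -/
instance homPartialOrder (X Y : KlF.{u}) : PartialOrder (X ⟶ Y) where
  le f g := ∀ x y, entry f x y ≤ entry g x y
  le_refl _ _ _ := le_rfl
  le_trans _ _ _ h₁ h₂ x y := (h₁ x y).trans (h₂ x y)
  le_antisymm _ _ h₁ h₂ := hom_ext fun x y => le_antisymm (h₁ x y) (h₂ x y)

/-- The pointwise supremum. -/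
noncomputable def sup {X Y : KlF.{u}} (d : Set (X ⟶ Y)) : X ⟶ Y :=
  KlFHom.mk fun x => ⟨fun y => ⨆ f : d, entry f.1 x y, haveI := Y.countable; Set.to_countable _⟩

theorem entry_sup {X Y : KlF.{u}} (d : Set (X ⟶ Y)) (x : X.carrier) (y : Y.carrier) :
    entry (sup d) x y = ⨆ f : d, entry f.1 x y := rfl

theorem isLUB_sup {X Y : KlF.{u}} (d : Set (X ⟶ Y)) : IsLUB d (sup d) :=
  ⟨fun f hf x y => le_iSup (fun f : d => entry f.1 x y) ⟨f, hf⟩,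
    fun _ hg x y => iSup_le fun f => hg f.2 x y⟩

theorem entry_sup_image {X Y X' Y' : KlF.{u}} (F : (X ⟶ Y) → (X' ⟶ Y')) (d : Set (X ⟶ Y))
    (x : X'.carrier) (y : Y'.carrier) :
    entry (sup (F '' d)) x y = ⨆ f : d, entry (F f.1) x y :=
  le_antisymm
    (iSup_le fun ⟨_, f, hf, e⟩ => e ▸ le_iSup (fun f : d => entry (F f.1) x y) ⟨f, hf⟩)
    (iSup_le fun ⟨f, hf⟩ =>
      le_iSup (fun g : ↥(F '' d) => entry g.1 x y) ⟨F f, Set.mem_image_of_mem F hf⟩)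

theorem entry_comp {X Y Z : KlF.{u}} (f : X ⟶ Y) (g : Y ⟶ Z) (x : X.carrier) (z : Z.carrier) :
    entry (f ≫ g) x z = ∑' y, entry f x y * entry g y z := rfl

theorem tsum_iSup_of_directed {ι α : Type*} [Nonempty ι] (a : α → ι → ℝ≥0∞)
    (h : ∀ i j, ∃ k, ∀ x, a x i ≤ a x k ∧ a x j ≤ a x k) :
    ∑' x, ⨆ i, a x i = ⨆ i, ∑' x, a x i := by
  simp_rw [ENNReal.tsum_eq_iSup_sum]
  rw [iSup_comm]
  exact iSup_congr fun s => ENNReal.finsetSum_iSup h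

noncomputable instance : DCpoJoinEnriched KlF.{u} where
  homOrder := homPartialOrder
  exists_isLUB_of_directed d _ _ := ⟨sup d, isLUB_sup d⟩
  exists_isLUB_pair f g := ⟨sup {f, g}, isLUB_sup _⟩
  scottContinuous_precomp {X Y} f Z d hd hdir a ha := by
    obtain rfl := ha.unique (isLUB_sup d)
    have hne : Nonempty d := hd.to_subtype
    have key : f ≫ sup d = sup ((fun h => f ≫ h) '' d) := hom_ext fun x z => by
      rw [entry_comp, entry_sup_image]
      simp_rw [entry_sup, ENNReal.mul_iSup, entry_comp]
      refine tsum_iSup_of_directed (fun y (h : d) => entry f x y * entry h.1 y z) ?_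
      rintro ⟨h, hh⟩ ⟨h', hh'⟩
      obtain ⟨k, hk, h1, h2⟩ := hdir h hh h' hh'
      exact ⟨⟨k, hk⟩, fun y => ⟨mul_le_mul_right (h1 y z) _, mul_le_mul_right (h2 y z) _⟩⟩
    simpa only [key] using isLUB_sup _
  scottContinuous_postcomp {Y Z} g X d hd hdir a ha := by
    obtain rfl := ha.unique (isLUB_sup d)
    have hne : Nonempty d := hd.to_subtype
    have key : sup d ≫ g = sup ((fun h => h ≫ g) '' d) := hom_ext fun x z => by
      rw [entry_comp, entry_sup_image]
      simp_rw [entry_sup, ENNReal.iSup_mul, entry_comp]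
      refine tsum_iSup_of_directed (fun y (h : d) => entry h.1 x y * entry g y z) ?_
      rintro ⟨h, hh⟩ ⟨h', hh'⟩
      obtain ⟨k, hk, h1, h2⟩ := hdir h hh h' hh'
      exact ⟨⟨k, hk⟩, fun y => ⟨mul_le_mul_left (h1 x y) _, mul_le_mul_left (h2 x y) _⟩⟩
    simpa only [key] using isLUB_sup _

/-- The inclusion `f ↦ f^♯ = η ∘ f` of maps of sets into the Kleisli category. -/
noncomputable def sharp {X Y : KlF.{u}} (f : X.carrier → Y.carrier) : X ⟶ Y :=
  KlFHom.mk fun x => FMonad.unit (f x)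

end KlF

/-- A relation `R` is a weak bisimulation on a Kleisli-valued lax functor `π` if it is the kernel
pair of a map of sets that is a weak behavioural morphism on `π`. -/
def IsWeakBisimulation {M : Type*} [AddMonoid M] {X : KlF.{u}} (π : LaxFlow M X)
    (R : X.carrier → X.carrier → Prop) : Prop :=
  ∃ (Y : KlF.{u}) (f : X.carrier → Y.carrier),
    (∀ i j, R i j ↔ f i = f j) ∧ π.IsWeakBehavioural (KlF.sharp f)

/-! ### Continuous-time Markov chains -/

section CTMC

variable {Ω : Type v} [MeasurableSpace Ω] {S : Type u}

/-- A continuous-time Markov chain with (almost surely) right-continuous paths in the discrete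
state space `S`. -/
structure IsCTMC (P : Measure Ω) (X : ℝ≥0 → Ω → S) : Prop where
  measurableSet_eq : ∀ t i, MeasurableSet {ω | X t ω = i}
  rightContinuous : ∀ᵐ ω ∂P, ∀ t, ∀ᶠ s in 𝓝[≥] t, X s ω = X t ω
  markov : ∀ (n : ℕ) (τ : Fin (n + 1) → ℝ≥0), StrictMono τ → ∀ (x : Fin (n + 1) → S) (t : ℝ≥0),
    τ (Fin.last n) < t → P {ω | ∀ k, X (τ k) ω = x k} ≠ 0 → ∀ j,
      P[{ω | X t ω = j} | {ω | ∀ k, X (τ k) ω = x k}] =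
        P[{ω | X t ω = j} | {ω | X (τ (Fin.last n)) ω = x (Fin.last n)}]

/-- Homogeneity: `ℙ(X_{s+t} = j | X_s = i) = ℙ(X_t = j | X_0 = i)` whenever the left-hand side is
defined. -/
def IsHomogeneous (P : Measure Ω) (X : ℝ≥0 → Ω → S) : Prop :=
  ∀ (s t : ℝ≥0) (i j : S), P {ω | X s ω = i} ≠ 0 →
    P[{ω | X (s + t) ω = j} | {ω | X s ω = i}] = P[{ω | X t ω = j} | {ω | X 0 ω = i}]

/-- The transition probability `p_{ij}(t) = ℙ(X_t = j | X_0 = i)`. -/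
noncomputable def transProb (P : Measure Ω) (X : ℝ≥0 → Ω → S) (t : ℝ≥0) (i j : S) : ℝ≥0∞ :=
  P[{ω | X t ω = j} | {ω | X 0 ω = i}]

/-- The hitting probability `p_{i,C} = ℙ(X_t ∈ C for some t ≥ 0 | X_0 = i)`. -/
noncomputable def hitProb (P : Measure Ω) (X : ℝ≥0 → Ω → S) (i : S) (C : Set S) : ℝ≥0∞ :=
  P[{ω | ∃ t, X t ω ∈ C} | {ω | X 0 ω = i}]

end CTMC

/-! Two least elements coincide. In $\widehat{\mathsf K}$, the saturation applied to $h$ is the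
least $H\ge h$ with $H\circ\pi_m\le H$ for all $m$ (`le_saturation_app`, `map_comp_saturation_le`,
`saturation_app_le`). For the chain, $i\mapsto p_{i,C}$ is the least $v:S\to[0,\infty]$ that is at
least $1$ on $C$ and excessive, i.e. $\sum_k p_{ik}(t)v_k\le v_i$ for all $t$
(`tsum_transProb_mul_hitProb_le`, `hitProb_le`). With $h=f^\sharp$ the first description, read
column by column, is the second with $C$ a fibre of $f$. So the saturation of $f^\sharp$ is the
matrix of hitting probabilities of the fibres (`saturation_app_sharp`), and it factors through the
quotient map when these are constant on classes.

Excessiveness holds because visiting $C$ after time $t$ implies visiting $C$. For minimality,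
right-continuity reduces hitting to dyadic time grids, where the Markov property gives a one-step
recursion that any competitor $v$ dominates. -/

/-! ### Suprema in `hat K` for the Kleisli category -/

namespace KlF

/-- The pointwise supremum of a set of morphisms of `hat K`. -/
noncomputable def hatSup {X Y : KlF.{u}} (D : Set (Hat.mk X ⟶ Hat.mk Y)) :
    Hat.mk X ⟶ Hat.mk Y :=
  HatHom.mk (fun Z h => sup ((fun φ : Hat.mk X ⟶ Hat.mk Y => HatHom.app φ Z h) '' D))
    (fun Z d hd hdir a ha => by
      constructor
      · rintro _ ⟨h, hh, rfl⟩
        refine (isLUB_sup _).2 ?_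
        rintro _ ⟨φ, hφ, rfl⟩
        exact ((HatHom.scottContinuous φ Z).monotone (ha.1 hh)).trans
          ((isLUB_sup _).1 ⟨φ, hφ, rfl⟩)
      · intro b hb
        refine (isLUB_sup _).2 ?_
        rintro _ ⟨φ, hφ, rfl⟩
        refine (HatHom.scottContinuous φ Z hd hdir ha).2 ?_
        rintro _ ⟨h, hh, rfl⟩
        exact le_trans ((isLUB_sup ((fun φ : Hat.mk X ⟶ Hat.mk Y => HatHom.app φ Z h) '' D)).1
          ⟨φ, hφ, rfl⟩) (hb ⟨h, hh, rfl⟩))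
    (fun {Z Z'} h g => by
      refine (isLUB_sup _).2 ?_
      rintro _ ⟨φ, hφ, rfl⟩
      exact (HatHom.oplax φ h g).trans
        ((DCpoJoinEnriched.scottContinuous_postcomp g X).monotone
          ((isLUB_sup ((fun φ : Hat.mk X ⟶ Hat.mk Y => HatHom.app φ Z h) '' D)).1 ⟨φ, hφ, rfl⟩)))

theorem isLUB_hatSup {X Y : KlF.{u}} (D : Set (Hat.mk X ⟶ Hat.mk Y)) : IsLUB D (hatSup D) := by
  constructor
  · intro φ hφ Z h
    exact (isLUB_sup _).1 ⟨φ, hφ, rfl⟩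
  · intro ψ hψ Z h
    refine (isLUB_sup _).2 ?_
    rintro _ ⟨φ, hφ, rfl⟩
    exact hψ hφ Z h

theorem entry_sharp_comp {X Y Z : KlF.{u}} (f : X.carrier → Y.carrier) (g : Y ⟶ Z)
    (x : X.carrier) (z : Z.carrier) : entry (sharp f ≫ g) x z = entry g (f x) z :=
  congrArg (fun φ : FMonad Z.carrier => φ z) (FMonad.unit_bind (f x) (KlFHom.app g))

end KlF

/-! ### Powers of an endomorphism in `hat K` -/

section Powers

variable {K : Type v} [Category.{w} K] [DCpoJoinEnriched K]

/-- The definition applies the additional `φ` innermost to `h`; closedness of the saturation needs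
it outermost. -/
theorem hatPow_succ' {X : Hat K} (φ : X ⟶ X) (l : ℕ) : hatPow φ (l + 1) = φ ≫ hatPow φ l := by
  induction l with
  | zero => exact (Category.id_comp φ).trans (Category.comp_id φ).symm
  | succ l ih =>
    change hatPow φ (l + 1) ≫ φ = φ ≫ (hatPow φ l ≫ φ)
    rw [ih, Category.assoc]

theorem hatPow_app_le {X Z : K} (ρ : Hat.mk X ⟶ Hat.mk X) {H : X ⟶ Z}
    (hH : HatHom.app ρ Z H ≤ H) (l : ℕ) {h : X ⟶ Z} (h_le : h ≤ H) :
    HatHom.app (hatPow ρ l) Z h ≤ H := by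
  induction l generalizing h with
  | zero => exact h_le
  | succ l ih => exact ih (((HatHom.scottContinuous ρ Z).monotone h_le).trans hH)

end Powers

/-! ### The saturation as a least closed morphism -/

namespace LaxFlow

variable {M : Type*} [AddMonoid M] {X : KlF.{u}} (π : LaxFlow M X)

/-- The join of all the morphisms `π̂(m)`. -/
noncomputable def hatJoin : Hat.mk X ⟶ Hat.mk X :=
  KlF.hatSup (Set.range fun m => hat (π.map m))

/-- The saturation, computed by pointwise suprema. -/
noncomputable def saturation : Hat.mk X ⟶ Hat.mk X :=
  KlF.hatSup (Set.range (hatPow π.hatJoin))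

theorem hat_map_le_hatJoin (m : M) : hat (π.map m) ≤ π.hatJoin :=
  (KlF.isLUB_hatSup _).1 ⟨m, rfl⟩

theorem isLUB_finiteJoins : IsLUB π.finiteJoins π.hatJoin := by
  constructor
  · rintro φ ⟨s, -, hφ⟩
    refine hφ.2 ?_
    rintro _ ⟨m, -, rfl⟩
    exact π.hat_map_le_hatJoin m
  · intro ψ hψ
    refine (KlF.isLUB_hatSup _).2 ?_
    rintro _ ⟨m, rfl⟩
    exact hψ ⟨{m}, Finset.singleton_nonempty m, by simp⟩

theorem isSaturation_saturation : π.IsSaturation π.saturation :=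
  ⟨π.hatJoin, π.isLUB_finiteJoins, KlF.isLUB_hatSup _⟩

/-- Laxity at the unit, `𝟙 ≤ π 0`, makes the join inflationary, so its powers form an increasing
chain. -/
theorem le_hatJoin_app {Z : KlF.{u}} (h : X ⟶ Z) : h ≤ HatHom.app π.hatJoin Z h := by
  have h1 : 𝟙 X ≫ h ≤ π.map 0 ≫ h :=
    (DCpoJoinEnriched.scottContinuous_postcomp h X).monotone π.id_le
  rw [Category.id_comp] at h1
  exact h1.trans (π.hat_map_le_hatJoin 0 Z h)

theorem hatPow_app_le_saturation {Z : KlF.{u}} (l : ℕ) (h : X ⟶ Z) :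
    HatHom.app (hatPow π.hatJoin l) Z h ≤ HatHom.app π.saturation Z h :=
  (KlF.isLUB_hatSup (Set.range (hatPow π.hatJoin))).1 ⟨l, rfl⟩ Z h

theorem monotone_hatPow_app {Z : KlF.{u}} (h : X ⟶ Z) :
    Monotone fun l => HatHom.app (hatPow π.hatJoin l) Z h :=
  monotone_nat_of_le_succ fun l =>
    (HatHom.scottContinuous (hatPow π.hatJoin l) Z).monotone (π.le_hatJoin_app h)

theorem isLUB_saturation_app {Z : KlF.{u}} (h : X ⟶ Z) :
    IsLUB (Set.range fun l => HatHom.app (hatPow π.hatJoin l) Z h)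
      (HatHom.app π.saturation Z h) := by
  have key := KlF.isLUB_sup
    ((fun φ : Hat.mk X ⟶ Hat.mk X => HatHom.app φ Z h) '' Set.range (hatPow π.hatJoin))
  have e : (Set.range fun l => HatHom.app (hatPow π.hatJoin l) Z h) =
      (fun φ : Hat.mk X ⟶ Hat.mk X => HatHom.app φ Z h) '' Set.range (hatPow π.hatJoin) :=
    Set.range_comp (fun φ : Hat.mk X ⟶ Hat.mk X => HatHom.app φ Z h) (hatPow π.hatJoin)
  rw [e]
  exact key

/-- Scott continuity moves `hatJoin` inside the supremum of the chain of powers, where it only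
shifts the index. -/
theorem hatJoin_saturation_app_le {Z : KlF.{u}} (h : X ⟶ Z) :
    HatHom.app π.hatJoin Z (HatHom.app π.saturation Z h) ≤ HatHom.app π.saturation Z h := by
  refine (HatHom.scottContinuous π.hatJoin Z (Set.range_nonempty _)
    (π.monotone_hatPow_app h).directed_le.directedOn_range (π.isLUB_saturation_app h)).2 ?_
  rintro _ ⟨_, ⟨l, rfl⟩, rfl⟩
  refine le_trans (le_of_eq ?_) (π.hatPow_app_le_saturation (l + 1) h)
  rw [hatPow_succ']
  rfl

theorem map_comp_saturation_le {Z : KlF.{u}} (m : M) (h : X ⟶ Z) :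
    π.map m ≫ HatHom.app π.saturation Z h ≤ HatHom.app π.saturation Z h :=
  (π.hat_map_le_hatJoin m Z _).trans (π.hatJoin_saturation_app_le h)

theorem le_saturation_app {Z : KlF.{u}} (h : X ⟶ Z) : h ≤ HatHom.app π.saturation Z h :=
  π.hatPow_app_le_saturation 0 h

/-- The saturation of `h` lies below every `H ≥ h` with `π(m) ≫ H ≤ H` for all `m`. -/
theorem saturation_app_le {Z : KlF.{u}} {h H : X ⟶ Z} (h_le : h ≤ H)
    (hH : ∀ m, π.map m ≫ H ≤ H) : HatHom.app π.saturation Z h ≤ H := by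
  refine (π.isLUB_saturation_app h).2 ?_
  rintro _ ⟨l, rfl⟩
  refine hatPow_app_le π.hatJoin ?_ l h_le
  refine (KlF.isLUB_sup _).2 ?_
  rintro _ ⟨_, ⟨m, rfl⟩, rfl⟩
  exact hH m

end LaxFlow

/-! ### Markov chains -/

section CTMC

variable {Ω : Type v} {S : Type u}

/-- `A` prescribes the states of `X` at finitely many times, the last of which is `s` with the
state `j`. -/
def IsPast (X : ℝ≥0 → Ω → S) (A : Set Ω) (s : ℝ≥0) (j : S) : Prop :=
  ∃ (n : ℕ) (τ : Fin (n + 1) → ℝ≥0) (x : Fin (n + 1) → S), StrictMono τ ∧ τ (Fin.last n) = s ∧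
    x (Fin.last n) = j ∧ A = {ω | ∀ k, X (τ k) ω = x k}

theorem isPast_single (X : ℝ≥0 → Ω → S) (s : ℝ≥0) (j : S) : IsPast X {ω | X s ω = j} s j :=
  ⟨0, fun _ => s, fun _ => j, Subsingleton.strictMono (α := Fin 1) _, rfl, rfl, by ext ω; simp⟩

variable {X : ℝ≥0 → Ω → S} {A : Set Ω} {s : ℝ≥0} {j : S}

theorem IsPast.snoc (hA : IsPast X A s j) {t : ℝ≥0} (ht : s < t) (k : S) :
    IsPast X (A ∩ {ω | X t ω = k}) t k := by
  obtain ⟨n, τ, x, hτ, rfl, rfl, rfl⟩ := hA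
  refine ⟨n + 1, Fin.snoc (α := fun _ => ℝ≥0) τ t, Fin.snoc (α := fun _ => S) x k, ?_, by simp,
    by simp, ?_⟩
  · refine Fin.strictMono_iff_lt_succ.2 fun i => ?_
    induction i using Fin.lastCases with
    | last => simpa using ht
    | cast i =>
      rw [Fin.succ_castSucc, Fin.snoc_castSucc, Fin.snoc_castSucc]
      exact hτ Fin.castSucc_lt_succ
  · ext ω
    simp [Fin.forall_fin_succ']

theorem IsPast.subset (hA : IsPast X A s j) : A ⊆ {ω | X s ω = j} := by
  obtain ⟨n, τ, x, -, rfl, rfl, rfl⟩ := hA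
  exact fun ω hω => hω _

variable [MeasurableSpace Ω] {P : Measure Ω}

theorem IsPast.measurableSet (hX : IsCTMC P X) (hA : IsPast X A s j) : MeasurableSet A := by
  obtain ⟨n, τ, x, -, -, -, rfl⟩ := hA
  rw [Set.ofPred_forall]
  exact MeasurableSet.iInter fun k => hX.measurableSet_eq _ _

theorem cond_eq_one_of_subset [IsProbabilityMeasure P] {A B : Set Ω} (hA : MeasurableSet A)
    (h0 : P A ≠ 0) (h : A ⊆ B) : P[B | A] = 1 := by
  rw [cond_apply hA, Set.inter_eq_left.2 h, ENNReal.inv_mul_cancel h0 (measure_ne_top _ _)]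

theorem transProb_zero_self [IsProbabilityMeasure P] (hX : IsCTMC P X)
    (hinit : ∀ i, P {ω | X 0 ω = i} ≠ 0) (i : S) : transProb P X 0 i i = 1 :=
  cond_eq_one_of_subset (hX.measurableSet_eq 0 i) (hinit i) subset_rfl

theorem transProb_zero_of_ne (hX : IsCTMC P X) {i j : S} (h : i ≠ j) :
    transProb P X 0 i j = 0 := by
  have h0 : {ω | X 0 ω = i} ∩ {ω | X 0 ω = j} = ∅ := by
    ext ω
    simp only [Set.mem_inter_iff, Set.mem_ofPred_eq, Set.mem_empty_iff_false, iff_false, not_and]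
    rintro rfl
    exact h
  rw [transProb, cond_apply (hX.measurableSet_eq 0 i), h0, measure_empty, mul_zero]

/-- The Markov property forgets all but the last state, and homogeneity moves the start to time 0.
The product form also covers null pasts. The step must be positive because `markov` concerns
strictly later times. -/
theorem IsPast.measure_inter [IsProbabilityMeasure P] (hX : IsCTMC P X) (hhom : IsHomogeneous P X)
    (hA : IsPast X A s j) {d : ℝ≥0} (hd : 0 < d) (k : S) :
    P (A ∩ {ω | X (s + d) ω = k}) = P A * transProb P X d j k := by
  by_cases h0 : P A = 0
  · rw [h0, zero_mul]
    exact measure_mono_null Set.inter_subset_left h0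
  have hm := hA.measurableSet hX
  have hs : P {ω | X s ω = j} ≠ 0 := fun h => h0 (measure_mono_null hA.subset h)
  have key : P[{ω | X (s + d) ω = k} | A] = transProb P X d j k := by
    rw [transProb, ← hhom s d j k hs]
    obtain ⟨n, τ, x, hτ, rfl, rfl, rfl⟩ := hA
    exact hX.markov n τ hτ x _ (lt_add_of_pos_right _ hd) h0 k
  rw [← key, mul_comm, cond_mul_eq_inter hm]

/-- Restricting `P` to `B` avoids any measurability of `B`, which will be a hitting event over
uncountably many times. -/
theorem IsCTMC.tsum_measure_inter [Countable S] (hX : IsCTMC P X) (t : ℝ≥0) (A B : Set Ω)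
    (hA : MeasurableSet A) : ∑' k, P (A ∩ {ω | X t ω = k} ∩ B) = P (A ∩ B) := by
  have hm : ∀ k, MeasurableSet (A ∩ {ω | X t ω = k}) := fun k => hA.inter (hX.measurableSet_eq t k)
  have hU : ⋃ k, A ∩ {ω | X t ω = k} = A := by
    ext ω
    simp
  have hd : Pairwise (Function.onFun Disjoint fun k => A ∩ {ω | X t ω = k}) := by
    intro k l hkl
    refine Set.disjoint_left.2 ?_
    rintro ω ⟨-, rfl⟩ ⟨-, h⟩
    exact hkl h
  have key := measure_iUnion (μ := P.restrict B) hd hm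
  rw [hU, Measure.restrict_apply hA] at key
  rw [key]
  exact tsum_congr fun k => (Measure.restrict_apply (hm k)).symm

/-- Chapman–Kolmogorov: split by the state at the intermediate time. Zero times are separate because
`IsPast.measure_inter` needs positive steps. -/
theorem transProb_add [Countable S] [IsProbabilityMeasure P] (hX : IsCTMC P X)
    (hhom : IsHomogeneous P X) (hinit : ∀ i, P {ω | X 0 ω = i} ≠ 0) (m n : ℝ≥0) (i j : S) :
    transProb P X (m + n) i j = ∑' k, transProb P X n i k * transProb P X m k j := by
  rcases eq_zero_or_pos n with rfl | hn
  · rw [tsum_eq_single i fun k hk => by rw [transProb_zero_of_ne hX hk.symm, zero_mul],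
      transProb_zero_self hX hinit, one_mul, add_zero]
  rcases eq_zero_or_pos m with rfl | hm
  · rw [tsum_eq_single j fun k hk => by rw [transProb_zero_of_ne hX hk, mul_zero],
      transProb_zero_self hX hinit, mul_one, zero_add]
  have hA := isPast_single X 0 i
  have hAm := hA.measurableSet hX
  refine (ENNReal.mul_right_inj (hinit i) (measure_ne_top P _)).1 ?_
  rw [← hA.measure_inter hX hhom (add_pos hm hn), ← hX.tsum_measure_inter n _ _ hAm,
    ← ENNReal.tsum_mul_left]
  refine tsum_congr fun k => ?_
  rw [← mul_assoc, ← hA.measure_inter hX hhom hn, zero_add, zero_add,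
    ← (hA.snoc hn k).measure_inter hX hhom hm, add_comm n m]

/-! ### Hitting probabilities -/

open Classical in
/-- The probability that the chain started in `j` visits `C` at one of the times
`0, δ, …, n δ`. -/
noncomputable def gridHit (P : Measure Ω) (X : ℝ≥0 → Ω → S) (δ : ℝ≥0) (C : Set S) :
    ℕ → S → ℝ≥0∞
  | 0, j => if j ∈ C then 1 else 0
  | n + 1, j => if j ∈ C then 1 else ∑' k, transProb P X δ j k * gridHit P X δ C n k

theorem gridHit_of_mem {δ : ℝ≥0} {C : Set S} (n : ℕ) (h : j ∈ C) : gridHit P X δ C n j = 1 := by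
  cases n <;> simp [gridHit, h]

/-- First-step analysis: outside `C`, split by the state at `s + δ` and append that state to the
past. The induction therefore has to range over all pasts. -/
theorem IsPast.measure_inter_grid [Countable S] [IsProbabilityMeasure P] (hX : IsCTMC P X)
    (hhom : IsHomogeneous P X) {δ : ℝ≥0} (hδ : 0 < δ) (C : Set S) (n : ℕ) (hA : IsPast X A s j) :
    P (A ∩ {ω | ∃ k ≤ n, X (s + k * δ) ω ∈ C}) = P A * gridHit P X δ C n j := by
  induction n generalizing A s j with
  | zero =>
    by_cases hj : j ∈ C
    · rw [gridHit_of_mem _ hj, mul_one, Set.inter_eq_left.2]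
      intro ω hω
      have := hA.subset hω
      simp_all
    · rw [gridHit, if_neg hj, mul_zero]
      refine measure_mono_null ?_ measure_empty
      rintro ω ⟨hω, k, hk, h⟩
      obtain rfl := Nat.le_zero.1 hk
      have := hA.subset hω
      simp_all
  | succ n ih =>
    by_cases hj : j ∈ C
    · rw [gridHit_of_mem _ hj, mul_one, Set.inter_eq_left.2]
      intro ω hω
      have h1 : X s ω = j := hA.subset hω
      exact ⟨0, Nat.zero_le _, by simpa [h1] using hj⟩
    · rw [gridHit, if_neg hj, ← hX.tsum_measure_inter (s + δ) _ _ (hA.measurableSet hX),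
        ← ENNReal.tsum_mul_left]
      refine tsum_congr fun k => ?_
      rw [← mul_assoc, ← hA.measure_inter hX hhom hδ, ← ih (hA.snoc (lt_add_of_pos_right s hδ) k)]
      congr 1
      ext ω
      -- Since `j ∉ C`, a visit cannot have grid index 0, so visits from `s` and from `s + δ`
      -- correspond by an index shift.
      refine and_congr_right fun hω => ?_
      have h1 : X s ω = j := hA.subset hω.1
      constructor
      · rintro ⟨l, hl, h⟩
        cases l with
        | zero => simp [h1, hj] at h
        | succ l =>
          refine ⟨l, by omega, ?_⟩
          convert h using 2
          push_cast
          ring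
      · rintro ⟨l, hl, h⟩
        refine ⟨l + 1, by omega, ?_⟩
        convert h using 2
        push_cast
        ring

/-- `v` is a supersolution of the recursion defining `gridHit`. -/
theorem gridHit_le {δ : ℝ≥0} {C : Set S} {v : S → ℝ≥0∞} (h1 : ∀ i ∈ C, 1 ≤ v i)
    (hv : ∀ i, ∑' k, transProb P X δ i k * v k ≤ v i) (n : ℕ) (i : S) :
    gridHit P X δ C n i ≤ v i := by
  induction n generalizing i with
  | zero =>
    by_cases hi : i ∈ C
    · rw [gridHit_of_mem _ hi]
      exact h1 i hi
    · simp [gridHit, hi]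
  | succ n ih =>
    by_cases hi : i ∈ C
    · rw [gridHit_of_mem _ hi]
      exact h1 i hi
    · rw [gridHit, if_neg hi]
      exact (ENNReal.tsum_le_tsum fun k => mul_le_mul_right (ih k) _).trans (hv i)

/-- A right-continuous path visiting `C` visits `C` at a dyadic time. -/
theorem exists_dyadic_mem {x : ℝ≥0 → S} (hx : ∀ t, ∀ᶠ r in 𝓝[≥] t, x r = x t) {C : Set S}
    (s t : ℝ≥0) (h : x (s + t) ∈ C) : ∃ m k : ℕ, x (s + k * (2⁻¹ : ℝ≥0) ^ m) ∈ C := by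
  -- The path is constant on `[s + t, b)`; a mesh smaller than this interval puts a grid point into
  -- it.
  obtain ⟨b, hb, hsub⟩ := (mem_nhdsGE_iff_exists_Ico_subset' (lt_add_one (s + t))).1 (hx (s + t))
  have hb' : s + t < b := hb
  obtain ⟨m, hm⟩ := exists_pow_lt_of_lt_one (tsub_pos_of_lt hb') (two_inv_lt_one (α := ℝ≥0))
  have hpos : (0 : ℝ≥0) < (2⁻¹ : ℝ≥0) ^ m := by positivity
  -- The first grid point at or after `s + t` overshoots by less than the mesh.
  refine ⟨m, ⌈t / (2⁻¹ : ℝ≥0) ^ m⌉₊, ?_⟩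
  have h1 : t ≤ ⌈t / (2⁻¹ : ℝ≥0) ^ m⌉₊ * (2⁻¹ : ℝ≥0) ^ m :=
    (div_le_iff₀ hpos).1 (Nat.le_ceil _)
  have h2 : ⌈t / (2⁻¹ : ℝ≥0) ^ m⌉₊ * (2⁻¹ : ℝ≥0) ^ m < t + (2⁻¹ : ℝ≥0) ^ m := by
    have := mul_lt_mul_of_pos_right (Nat.ceil_lt_add_one (zero_le (a := t / (2⁻¹ : ℝ≥0) ^ m))) hpos
    rwa [add_mul, one_mul, div_mul_cancel₀ _ hpos.ne'] at this
  have h3 : x (s + ⌈t / (2⁻¹ : ℝ≥0) ^ m⌉₊ * (2⁻¹ : ℝ≥0) ^ m) = x (s + t) := by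
    refine hsub ⟨add_le_add_right h1 s, ?_⟩
    calc s + ⌈t / (2⁻¹ : ℝ≥0) ^ m⌉₊ * (2⁻¹ : ℝ≥0) ^ m
        < s + (t + (2⁻¹ : ℝ≥0) ^ m) := add_lt_add_right h2 s
      _ = s + t + (2⁻¹ : ℝ≥0) ^ m := (add_assoc _ _ _).symm
      _ < b := by rw [add_comm]; exact lt_tsub_iff_right.1 hm
  rwa [h3]

/-- Almost surely, hitting is a countable union of grid events. They increase in `n`, and their
unions over `n` increase in `m`, so continuity from below applies twice. -/
theorem IsPast.measure_inter_hit_eq_iSup [Countable S] [IsProbabilityMeasure P] (hX : IsCTMC P X)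
    (hhom : IsHomogeneous P X) (C : Set S) (hA : IsPast X A s j) :
    P (A ∩ {ω | ∃ t, X (s + t) ω ∈ C}) =
      P A * ⨆ m : ℕ, ⨆ n, gridHit P X ((2⁻¹ : ℝ≥0) ^ m) C n j := by
  have hae : (A ∩ {ω | ∃ t, X (s + t) ω ∈ C} : Set Ω) =ᵐ[P]
      ⋃ m : ℕ, ⋃ n : ℕ, A ∩ {ω | ∃ k ≤ n, X (s + k * (2⁻¹ : ℝ≥0) ^ m) ω ∈ C} := by
    filter_upwards [hX.rightContinuous] with ω hω
    refine propext ⟨?_, fun h => ?_⟩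
    · rintro ⟨hA, t, ht⟩
      obtain ⟨m, k, h⟩ := exists_dyadic_mem (x := fun t => X t ω) hω s t ht
      exact Set.mem_iUnion.2 ⟨m, Set.mem_iUnion.2 ⟨k, hA, k, le_rfl, h⟩⟩
    · obtain ⟨m, hm⟩ := Set.mem_iUnion.1 h
      obtain ⟨n, hA, k, -, h⟩ := Set.mem_iUnion.1 hm
      exact ⟨hA, _, h⟩
  have hmono : ∀ m : ℕ, Monotone fun n : ℕ =>
      A ∩ {ω | ∃ k ≤ n, X (s + k * (2⁻¹ : ℝ≥0) ^ m) ω ∈ C} := by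
    rintro m n n' hn ω ⟨hA, k, hk, h⟩
    exact ⟨hA, k, hk.trans hn, h⟩
  have hmono' : Monotone fun m : ℕ => ⋃ n : ℕ,
      A ∩ {ω | ∃ k ≤ n, X (s + k * (2⁻¹ : ℝ≥0) ^ m) ω ∈ C} := by
    refine monotone_nat_of_le_succ fun m ω hω => ?_
    obtain ⟨n, hA, k, -, h⟩ := Set.mem_iUnion.1 hω
    -- Halving the mesh doubles the index of a grid point.
    refine Set.mem_iUnion.2 ⟨2 * k, hA, 2 * k, le_rfl, ?_⟩
    have h2 : ((2 * k : ℕ) : ℝ≥0) * (2⁻¹ : ℝ≥0) ^ (m + 1) = k * (2⁻¹ : ℝ≥0) ^ m := by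
      rw [pow_succ]
      push_cast
      field_simp
    rwa [h2]
  rw [measure_congr hae, hmono'.measure_iUnion, ENNReal.mul_iSup]
  refine iSup_congr fun m => ?_
  rw [(hmono m).measure_iUnion, ENNReal.mul_iSup]
  exact iSup_congr fun n => hA.measure_inter_grid hX hhom (by positivity) C n

theorem hitProb_eq_iSup [Countable S] [IsProbabilityMeasure P] (hX : IsCTMC P X)
    (hhom : IsHomogeneous P X) (hinit : ∀ i, P {ω | X 0 ω = i} ≠ 0) (i : S) (C : Set S) :
    hitProb P X i C = ⨆ m : ℕ, ⨆ n, gridHit P X ((2⁻¹ : ℝ≥0) ^ m) C n i := by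
  have h := (isPast_single X 0 i).measure_inter_hit_eq_iSup hX hhom C
  simp only [zero_add] at h
  rw [hitProb, cond_apply (hX.measurableSet_eq 0 i), h, ← mul_assoc,
    ENNReal.inv_mul_cancel (hinit i) (measure_ne_top _ _), one_mul]

theorem hitProb_of_mem [IsProbabilityMeasure P] (hX : IsCTMC P X)
    (hinit : ∀ i, P {ω | X 0 ω = i} ≠ 0) {i : S} {C : Set S} (hi : i ∈ C) :
    hitProb P X i C = 1 := by
  refine cond_eq_one_of_subset (hX.measurableSet_eq 0 i) (hinit i) ?_
  rintro ω rfl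
  exact ⟨0, hi⟩

theorem tsum_transProb_zero_mul [IsProbabilityMeasure P] (hX : IsCTMC P X)
    (hinit : ∀ i, P {ω | X 0 ω = i} ≠ 0) (i : S) (v : S → ℝ≥0∞) :
    ∑' k, transProb P X 0 i k * v k = v i := by
  rw [tsum_eq_single i fun k hk => by rw [transProb_zero_of_ne hX hk.symm, zero_mul],
    transProb_zero_self hX hinit, one_mul]

/-- Hitting probabilities are excessive. -/
theorem tsum_transProb_mul_hitProb_le [Countable S] [IsProbabilityMeasure P] (hX : IsCTMC P X)
    (hhom : IsHomogeneous P X) (hinit : ∀ i, P {ω | X 0 ω = i} ≠ 0) (C : Set S) (t : ℝ≥0) (i : S) :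
    ∑' k, transProb P X t i k * hitProb P X k C ≤ hitProb P X i C := by
  rcases eq_zero_or_pos t with rfl | ht
  · exact (tsum_transProb_zero_mul hX hinit i _).le
  have hA := isPast_single X 0 i
  refine (ENNReal.mul_le_mul_iff_right (hinit i) (measure_ne_top P _)).1 ?_
  have h1 : P {ω | X 0 ω = i} * ∑' k, transProb P X t i k * hitProb P X k C =
      P ({ω | X 0 ω = i} ∩ {ω | ∃ r, X (t + r) ω ∈ C}) := by
    rw [← hX.tsum_measure_inter t _ _ (hA.measurableSet hX), ← ENNReal.tsum_mul_left]
    refine tsum_congr fun k => ?_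
    rw [(hA.snoc ht k).measure_inter_hit_eq_iSup hX hhom, ← hitProb_eq_iSup hX hhom hinit,
      ← mul_assoc, ← hA.measure_inter hX hhom ht, zero_add]
  have h2 := hA.measure_inter_hit_eq_iSup hX hhom C
  rw [← hitProb_eq_iSup hX hhom hinit] at h2
  rw [h1, ← h2]
  refine measure_mono (Set.inter_subset_inter_right _ ?_)
  rintro ω ⟨r, hr⟩
  exact ⟨t + r, by rwa [zero_add]⟩

/-- Hitting probabilities are minimal among the excessive functions that are at least `1`
on `C`. -/
theorem hitProb_le [Countable S] [IsProbabilityMeasure P] (hX : IsCTMC P X)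
    (hhom : IsHomogeneous P X) (hinit : ∀ i, P {ω | X 0 ω = i} ≠ 0) {C : Set S} {v : S → ℝ≥0∞}
    (h1 : ∀ i ∈ C, 1 ≤ v i) (hv : ∀ t i, ∑' k, transProb P X t i k * v k ≤ v i) (i : S) :
    hitProb P X i C ≤ v i := by
  rw [hitProb_eq_iSup hX hhom hinit]
  exact iSup_le fun m => iSup_le fun n => gridHit_le h1 (hv _) n i

/-- The supremum is attained at `t = 0`, where the transition matrix is the identity; excessiveness
bounds the other terms. -/
theorem hitProb_eq_iSup_tsum [Countable S] [IsProbabilityMeasure P] (hX : IsCTMC P X)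
    (hhom : IsHomogeneous P X) (hinit : ∀ i, P {ω | X 0 ω = i} ≠ 0) (i : S) (C : Set S) :
    hitProb P X i C = ⨆ t : ℝ≥0, ∑' j : S, hitProb P X j C * transProb P X t i j := by
  simp_rw [mul_comm (hitProb P X _ C)]
  refine le_antisymm ?_ (iSup_le fun t => tsum_transProb_mul_hitProb_le hX hhom hinit C t i)
  exact (tsum_transProb_zero_mul hX hinit i fun k => hitProb P X k C).ge.trans
    (le_iSup (fun t => ∑' j, transProb P X t i j * hitProb P X j C) 0)

/-! ### The functor of transition probabilities -/

/-- A matrix of extended nonnegative reals as a Kleisli morphism. -/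
def KlF.ofEntries {Y Z : KlF.{u}} (a : Y.carrier → Z.carrier → ℝ≥0∞) : Y ⟶ Z :=
  KlFHom.mk fun y => ⟨a y, haveI := Z.countable; Set.to_countable _⟩

/-- The transition probabilities at time `t` as a Kleisli morphism. -/
noncomputable def transHom [Countable S] (P : Measure Ω) (X : ℝ≥0 → Ω → S) (t : ℝ≥0) : KlF.of S ⟶ KlF.of S :=
  KlF.ofEntries (Y := KlF.of S) (Z := KlF.of S) (transProb P X t)

theorem transHom_zero [Countable S] [IsProbabilityMeasure P] (hX : IsCTMC P X)
    (hinit : ∀ i, P {ω | X 0 ω = i} ≠ 0) : transHom P X 0 = 𝟙 (KlF.of S) := by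
  refine KlF.hom_ext fun (i j : S) => ?_
  change transProb P X 0 i j = (FMonad.unit i : FMonad S) j
  by_cases h : j = i
  · subst h
    simp [FMonad.unit, transProb_zero_self hX hinit]
  · simp [FMonad.unit, h, transProb_zero_of_ne hX (Ne.symm h)]

theorem transHom_add [Countable S] [IsProbabilityMeasure P] (hX : IsCTMC P X)
    (hhom : IsHomogeneous P X) (hinit : ∀ i, P {ω | X 0 ω = i} ≠ 0) (m n : ℝ≥0) :
    transHom P X (m + n) = transHom P X n ≫ transHom P X m :=
  KlF.hom_ext fun i j => transProb_add hX hhom hinit m n i j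

/-- The functor of transition probabilities. -/
noncomputable def transFlow [Countable S] [IsProbabilityMeasure P] (hX : IsCTMC P X)
    (hhom : IsHomogeneous P X) (hinit : ∀ i, P {ω | X 0 ω = i} ≠ 0) :
    LaxFlow ℝ≥0 (KlF.of S) where
  map := transHom P X
  id_le := (transHom_zero hX hinit).ge
  comp_le m n := (transHom_add hX hhom hinit m n).ge

/-- The saturation of the transition functor, applied to a map of sets, consists of the hitting
probabilities of the fibres. -/
theorem saturation_app_sharp [Countable S] [IsProbabilityMeasure P] (hX : IsCTMC P X)
    (hhom : IsHomogeneous P X) (hinit : ∀ i, P {ω | X 0 ω = i} ≠ 0) {Y : KlF.{u}}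
    (f : S → Y.carrier) :
    HatHom.app (transFlow hX hhom hinit).saturation Y (KlF.sharp (X := KlF.of S) f) =
      KlF.ofEntries (Y := KlF.of S) fun (i : S) y => hitProb P X i {j | f j = y} := by
  set π := transFlow hX hhom hinit
  refine le_antisymm (π.saturation_app_le ?_ fun t => ?_) ?_
  · intro (i : S) y
    change (FMonad.unit (f i)) y ≤ hitProb P X i {j | f j = y}
    by_cases h : y = f i
    · rw [hitProb_of_mem hX hinit (C := {j | f j = y}) h.symm]
      simp [FMonad.unit, h]
    · simp [FMonad.unit, h]
  · intro (i : S) y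
    exact tsum_transProb_mul_hitProb_le hX hhom hinit {j | f j = y} t i
  · intro (i : S) y
    -- Column `y` of the saturation is a competitor in the minimality of hitting probabilities.
    refine hitProb_le hX hhom hinit (C := {j | f j = y})
      (v := fun i => KlF.entry (HatHom.app π.saturation Y (KlF.sharp (X := KlF.of S) f)) i y)
      (fun j hj => ?_) (fun t j => ?_) i
    · refine le_trans ?_ (π.le_saturation_app (KlF.sharp (X := KlF.of S) f) j y)
      change 1 ≤ (FMonad.unit (f j)) y
      have hj' : y = f j := Eq.symm hj
      simp [FMonad.unit, hj']
    · exact π.map_comp_saturation_le t (KlF.sharp (X := KlF.of S) f) j y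

/-- The fibres of the quotient map are the classes of `R`, so the hypothesis is exactly what makes
the matrix of hitting probabilities descend to the required `β` on the quotient. -/
theorem isWeakBisimulation_transFlow [Countable S] [IsProbabilityMeasure P] (hX : IsCTMC P X)
    (hhom : IsHomogeneous P X) (hinit : ∀ i, P {ω | X 0 ω = i} ≠ 0) (R : Setoid S)
    (hR : ∀ i j : S, R i j → ∀ C ∈ R.classes, hitProb P X i C = hitProb P X j C) :
    IsWeakBisimulation (transFlow hX hhom hinit) R := by
  let f : S → Quotient R := Quotient.mk R
  have hcl : ∀ c : Quotient R, {j | f j = c} ∈ R.classes := by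
    intro c
    induction c using Quotient.inductionOn with
    | h y => exact ⟨y, Set.ext fun x => Quotient.eq⟩
  refine ⟨KlF.of (Quotient R), f, fun i j => Quotient.eq.symm,
    KlF.ofEntries (Y := KlF.of (Quotient R)) (Z := KlF.of (Quotient R)) fun c c' =>
      Quotient.lift (s := R) (fun i => hitProb P X i {j | f j = c'})
        (fun i j hij => hR i j hij _ (hcl c')) c,
    _, (transFlow hX hhom hinit).isSaturation_saturation, ?_⟩
  change HatHom.app (transFlow hX hhom hinit).saturation _
      (KlF.sharp (X := KlF.of S) (Y := KlF.of (Quotient R)) f ≫ 𝟙 _) =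
    KlF.sharp (X := KlF.of S) (Y := KlF.of (Quotient R)) f ≫ KlF.ofEntries _ ≫ 𝟙 _
  rw [Category.comp_id, Category.comp_id]
  refine (saturation_app_sharp hX hhom hinit (Y := KlF.of (Quotient R)) f).trans ?_
  refine KlF.hom_ext fun i c => Eq.trans ?_
    (KlF.entry_sharp_comp (X := KlF.of S) (Y := KlF.of (Quotient R)) f _ i c).symm
  rfl

end CTMC

theorem mainTheorem6 {Ω : Type v} [MeasurableSpace Ω] (P : Measure Ω) [IsProbabilityMeasure P]
    {S : Type u} [Countable S] (X : ℝ≥0 → Ω → S)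
    (hX : IsCTMC P X) (hhom : IsHomogeneous P X) (hinit : ∀ i, P {ω | X 0 ω = i} ≠ 0) :
    ∃ π : LaxFlow ℝ≥0 (KlF.of S),
      π.IsStrict ∧
      (∀ (t : ℝ≥0) (i j : S), KlF.entry (π.map t) i j = transProb P X t i j) ∧
      ∀ R : Setoid S,
        (∀ C ∈ R.classes, ∀ i : S,
          (i ∈ C → hitProb P X i C = 1) ∧
          (i ∉ C → hitProb P X i C =
            ⨆ t : ℝ≥0, ∑' j : S, hitProb P X j C * transProb P X t i j)) ∧
        ((∀ i j : S, R i j → ∀ C ∈ R.classes, hitProb P X i C = hitProb P X j C) →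
          IsWeakBisimulation π R) :=
  ⟨transFlow hX hhom hinit, ⟨transHom_zero hX hinit, transHom_add hX hhom hinit⟩,
    fun _ _ _ => rfl, fun R => ⟨fun C _ i => ⟨hitProb_of_mem hX hinit,
      fun _ => hitProb_eq_iSup_tsum hX hhom hinit i C⟩,
      isWeakBisimulation_transFlow hX hhom hinit R⟩⟩
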